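/- Let $\mathbb{A}$ be one of the normed division algebras $\mathbb{R},\mathbb{C},\mathbb{H},\mathbb{O}$, with its standard Euclidean inner product; here $\mathbb{O}=\mathbb{H}\oplus\mathbb{H}$ with the Cayley--Dickson product $(a,b)(c,d)=(ac-d\bar b,\ \bar a d+cb)$. Let $\mathbb{A}^n$ carry the inner product $\langle u,v\rangle=\sum_i\langle u_i,v_i\rangle$ and the componentwise right multiplication $(vx)_i=v_ix$. Let $SO(\mathbb{A})$ be the group of real-linear isometries of $\mathbb{A}$ of determinant $1$, and let $G_{\mathbb{A}}(n)$ be the group of all real-linear isometries $\phi$ of $\mathbb{A}^n$ for which there is $\theta\in SO(\mathbb{A})$ such that $\phi(vx)=\phi(v)\theta(x)$ for all $v\in\mathbb{A}^n$ and $x\in\mathbb{A}$. Then: 1. For every $n$, $G_{\mathbb{R}}(n)=O(n)$: the maps in $G_{\mathbb{R}}(n)$ are exactly the maps $v\mapsto Bv$ with $B$ a real orthogonal $n\times n$ matrix. 2. For every $n$, $G_{\mathbb{C}}(n)=U(n)$: the maps in $G_{\mathbb{C}}(n)$ are exactly the maps $v\mapsto Bv$ with $B$ a complex unitary $n\times n$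 matrix. 3. For every $n$, $G_{\mathbb{H}}(n)=Sp(n)Sp(1)$: let $Sp(n)$ be the group of quaternionic $n\times n$ matrices $B$ with $B^*B=BB^*=1$, and $Sp(1)$ the group of unit quaternions. Then $(B,q)\mapsto(v\mapsto Bvq^{-1})$ is a homomorphism from $Sp(n)\times Sp(1)$ to the group of real-linear isometries of $\mathbb{H}^n$ with image $G_{\mathbb{H}}(n)$, and for $n\ge 1$ its kernel is $\{(1,1),(-1,-1)\}$. 4. $G_{\mathbb{O}}(1)=Spin(7)$: there are a representation $\Psi$ of the even Clifford algebra of Euclidean $\mathbb{R}^7$ by real-linear endomorphisms of $\mathbb{O}$ and a group isomorphism $e\colon Spin(7)\to G_{\mathbb{O}}(1)$ such that $e(s)=\Psi(s)$ for all $s\in Spin(7)$; that is, $Spin(7)$ acts on $\mathbb{O}=\mathbb{R}^8$ by its spin representation. -/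

import Mathlib

open scoped Quaternion Matrix

noncomputable section

/-- The octonions `𝕆 = ℍ ⊕ ℍ` (Cayley–Dickson doubling of the quaternions), with the Euclidean
inner product of `ℝ⁸ = ℍ ⊕ ℍ`. -/
def Octonion : Type := WithLp 2 (ℍ[ℝ] × ℍ[ℝ])

namespace Octonion

instance : NormedAddCommGroup Octonion :=
  inferInstanceAs (NormedAddCommGroup (WithLp 2 (ℍ[ℝ] × ℍ[ℝ])))

instance : InnerProductSpace ℝ Octonion :=
  inferInstanceAs (InnerProductSpace ℝ (WithLp 2 (ℍ[ℝ] × ℍ[ℝ])))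

/-- The octonion `(a, b)`. -/
def mk (a b : ℍ[ℝ]) : Octonion := WithLp.toLp 2 (a, b)

/-- The first quaternionic component. -/
def fst (x : Octonion) : ℍ[ℝ] := (WithLp.ofLp x).1

/-- The second quaternionic component. -/
def snd (x : Octonion) : ℍ[ℝ] := (WithLp.ofLp x).2

/-- Cayley–Dickson multiplication `(a, b)(c, d) = (a c - d b*, a* d + c b)`. -/
instance : Mul Octonion where
  mul x y := mk (x.fst * y.fst - y.snd * star x.snd) (star x.fst * y.snd + y.fst * x.snd)

end Octonion

section Twisted

variable (A : Type*) [NormedAddCommGroup A] [InnerProductSpace ℝ A]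

/-- `Aⁿ` with the inner product `⟨u, v⟩ = ∑ i, ⟨u i, v i⟩`. -/
abbrev LinearSpaceOver (n : ℕ) : Type _ := PiLp 2 (fun _ : Fin n => A)

/-- `SO(A)`: the real-linear isometries of `A` of determinant one. -/
def specialOrthogonal : Subgroup (A ≃ₗᵢ[ℝ] A) where
  carrier := {θ | LinearMap.det (θ.toLinearEquiv : A →ₗ[ℝ] A) = 1}
  one_mem' := by
    change LinearMap.det (LinearMap.id : A →ₗ[ℝ] A) = 1
    exact LinearMap.det_id
  mul_mem' := by
    intro a b ha hb
    change LinearMap.det ((a.toLinearEquiv : A →ₗ[ℝ] A) ∘ₗ (b.toLinearEquiv : A →ₗ[ℝ] A)) = 1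
    rw [LinearMap.det_comp, show LinearMap.det (a.toLinearEquiv : A →ₗ[ℝ] A) = 1 from ha,
      show LinearMap.det (b.toLinearEquiv : A →ₗ[ℝ] A) = 1 from hb, one_mul]
  inv_mem' := by
    intro a ha
    change LinearMap.det (a.toLinearEquiv.symm : A →ₗ[ℝ] A) = 1
    have h := a.toLinearEquiv.det_symm_mul_det
    rwa [show LinearMap.det (a.toLinearEquiv : A →ₗ[ℝ] A) = 1 from ha, mul_one] at h

variable {A} in
/-- Right multiplication of a vector of `Aⁿ` by an element of `A`. -/
def rightMul [Mul A] {n : ℕ} (v : LinearSpaceOver A n) (x : A) : LinearSpaceOver A n :=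
  WithLp.toLp 2 (fun i => v i * x)

/-- `G_A(n)`: the group of twisted isomorphisms of `Aⁿ`, i.e. of the real-linear isometries `φ`
for which there is `θ ∈ SO(A)` with `φ (v x) = φ(v) θ(x)` for all `v` and `x`. -/
def twistedIso [Mul A] (n : ℕ) :
    Subgroup (LinearSpaceOver A n ≃ₗᵢ[ℝ] LinearSpaceOver A n) where
  carrier := {φ | ∃ θ ∈ specialOrthogonal A, ∀ (v : LinearSpaceOver A n) (x : A),
    φ (rightMul v x) = rightMul (φ v) (θ x)}
  one_mem' := ⟨1, one_mem _, fun _ _ => rfl⟩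
  mul_mem' := by
    rintro φ ψ ⟨θ, hθ, h⟩ ⟨η, hη, k⟩
    refine ⟨θ * η, mul_mem hθ hη, fun v x => ?_⟩
    change φ (ψ (rightMul v x)) = rightMul (φ (ψ v)) (θ (η x))
    rw [k, h]
  inv_mem' := by
    rintro φ ⟨θ, hθ, h⟩
    refine ⟨θ⁻¹, inv_mem hθ, fun v x => ?_⟩
    change φ.symm (rightMul v x) = rightMul (φ.symm v) (θ.symm x)
    rw [LinearIsometryEquiv.symm_apply_eq, h, φ.apply_symm_apply, θ.apply_symm_apply]

end Twisted

/-- `Sp(n)`: the quaternionic `n × n` matrices with `A* A = A A* = 1`. -/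
abbrev compactSp (n : ℕ) : Submonoid (Matrix (Fin n) (Fin n) ℍ[ℝ]) :=
  unitary (Matrix (Fin n) (Fin n) ℍ[ℝ])

/-- `Sp(1)`: the unit quaternions. -/
abbrev unitQuaternion : Submonoid ℍ[ℝ] := unitary ℍ[ℝ]

/-- The standard positive definite quadratic form `x₁² + ⋯ + x₇²` on `ℝ⁷`. -/
def euclideanForm7 : QuadraticForm ℝ (Fin 7 → ℝ) :=
  QuadraticMap.weightedSumSquares ℝ (fun _ : Fin 7 => (1 : ℝ))

/-- `Spin(7)`, inside the Clifford algebra of the Euclidean space `ℝ⁷`. -/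
abbrev Spin7 : Submonoid (CliffordAlgebra euclideanForm7) := spinGroup euclideanForm7

/-- `Spin(7)` lies in the even Clifford algebra. -/
def Spin7.toEven (s : Spin7) : CliffordAlgebra.even euclideanForm7 :=
  ⟨s, spinGroup.mem_even s.2⟩

end

/-!
Let `φ ∈ G_A(n)` be twisted by `θ`; evaluating at a vector with an invertible component of its
image shows `θ 1 = 1` and, when `A` is associative, that `θ` is multiplicative. For `ℝ` and `ℂ` the
only such rotation is the identity, so `φ` is `A`-linear, i.e. given by a unitary matrix. For `ℍ`,
averages `∑ₐ θ (eₐ) w ēₐ` over an orthonormal basis intertwine `θ` with the identity, and some `w`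
gives a nonzero one, so `θ` is conjugation by a unit quaternion `q`, and `φ` followed by right
multiplication by `q` is `ℍ`-linear.

For `𝕆`, right multiplication by an imaginary octonion `u` squares to `-‖u‖²`, so the even Clifford
algebra of `Im 𝕆 = ℝ⁷` acts on `𝕆`. Since `θ` fixes `1`, it is a rotation of `Im 𝕆`, hence a product
of reflections, and it lifts to an `s ∈ Spin(7)` whose action is also twisted by `θ`. Then `s⁻¹ φ`
commutes with all right multiplications, so it is left multiplication by an octonion `a` with
`a (x y) = (a x) y` for all `x, y`. Such an `a` is real, hence `±1`, and `-1 ∈ Spin(7)` acts as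
`-1`.
-/

noncomputable section

section Representations

variable {G E : Type*} [Group G] [NormedAddCommGroup E] [NormedSpace ℝ E]

/-- The action of a group by linear isometries which a norm-preserving representation affords. -/
def isometryRep (ρ : Representation ℝ G E) (hρ : ∀ g v, ‖ρ g v‖ = ‖v‖) : G →* (E ≃ₗᵢ[ℝ] E) where
  toFun g := ⟨LinearMap.GeneralLinearGroup.generalLinearEquiv ℝ E (ρ.toHomUnits g), hρ g⟩
  map_one' := LinearIsometryEquiv.ext fun v => by
    change ρ 1 v = v
    rw [map_one, Module.End.one_apply]
  map_mul' g h := LinearIsometryEquiv.ext fun v => by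
    change ρ (g * h) v = ρ g (ρ h v)
    rw [map_mul, Module.End.mul_apply]

end Representations

section Twists

variable {A : Type*} {n : ℕ}

theorem rightMul_one [MulOneClass A] (v : LinearSpaceOver A n) : rightMul v 1 = v :=
  PiLp.ext fun i => mul_one (v i)

theorem rightMul_neg_one [NonAssocRing A] (v : LinearSpaceOver A n) :
    rightMul v (-1) = -v :=
  PiLp.ext fun i => mul_neg_one (v i)

theorem rightMul_mul [Semigroup A] (v : LinearSpaceOver A n) (x y : A) :
    rightMul v (x * y) = rightMul (rightMul v x) y :=
  PiLp.ext fun i => (mul_assoc (v i) x y).symm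

theorem rightMul_injective [Mul A] [Zero A] [IsLeftCancelMulZero A] {v : LinearSpaceOver A n}
    {i : Fin n} (hi : v i ≠ 0) : Function.Injective (rightMul v) := fun _ _ h =>
  mul_left_cancel₀ hi (congrArg (fun w : LinearSpaceOver A n => w i) h)

variable {φ : LinearSpaceOver A n → LinearSpaceOver A n} {θ : A → A}

theorem twist_map_one [MulOneClass A] [Zero A] [IsLeftCancelMulZero A]
    (h : ∀ v x, φ (rightMul v x) = rightMul (φ v) (θ x)) {v : LinearSpaceOver A n} {i : Fin n}
    (hi : φ v i ≠ 0) : θ 1 = 1 :=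
  rightMul_injective hi (by rw [← h, rightMul_one, rightMul_one])

theorem twist_map_mul [Semigroup A] [Zero A] [IsLeftCancelMulZero A]
    (h : ∀ v x, φ (rightMul v x) = rightMul (φ v) (θ x)) {v : LinearSpaceOver A n} {i : Fin n}
    (hi : φ v i ≠ 0) (x y : A) : θ (x * y) = θ x * θ y :=
  rightMul_injective hi (by rw [← h, rightMul_mul, rightMul_mul, h, h])

theorem exists_isometry_apply_ne_zero [NormedAddCommGroup A] [NormedSpace ℝ A] [Nontrivial A]
    [NeZero n] (φ : LinearSpaceOver A n ≃ₗᵢ[ℝ] LinearSpaceOver A n) : ∃ v i, φ v i ≠ 0 := by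
  obtain ⟨v, hv⟩ := exists_ne (0 : LinearSpaceOver A n)
  by_contra! h
  exact hv (φ.map_eq_zero_iff.1 (PiLp.ext (h v)))

end Twists

section UnitaryMatrices

/-- The inner product of `A` makes left multiplication by `star a` adjoint to left
multiplication by `a`. -/
class StarAdjoint (A : Type*) [NormedRing A] [StarRing A] [InnerProductSpace ℝ A] : Prop where
  inner_mul_left (a x y : A) : inner ℝ (a * x) y = inner ℝ x (star a * y)

instance : StarAdjoint ℝ where
  inner_mul_left a x y := by
    rw [star_trivial, Real.inner_apply, Real.inner_apply, mul_comm a x, mul_assoc]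

instance : StarAdjoint ℂ where
  inner_mul_left a x y := by
    simp only [Complex.inner, Complex.star_def, map_mul]
    ring_nf

instance : StarAdjoint ℍ[ℝ] where
  inner_mul_left a x y := by
    simp only [Quaternion.inner_def, Quaternion.re_mul, Quaternion.re_star, Quaternion.imI_star,
      Quaternion.imJ_star, Quaternion.imK_star, Quaternion.imI_mul, Quaternion.imJ_mul,
      Quaternion.imK_mul]
    ring

theorem exists_mulVec_of_rightMul {A : Type*} [NormedRing A] {n : ℕ}
    (φ : LinearSpaceOver A n →+ LinearSpaceOver A n)
    (hφ : ∀ v x, φ (rightMul v x) = rightMul (φ v) x) :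
    ∃ B : Matrix (Fin n) (Fin n) A, ∀ v, φ v = WithLp.toLp 2 (B *ᵥ WithLp.ofLp v) := by
  refine ⟨Matrix.of fun i j => φ (PiLp.single 2 j 1) i, fun v => ?_⟩
  have decomposition : v = ∑ j, rightMul (PiLp.single 2 j 1) (v j) := by
    ext i
    simp [rightMul]
  conv_lhs => rw [decomposition, map_sum]
  simp only [hφ]
  ext i
  simp [rightMul, Matrix.mulVec, dotProduct]

variable {A : Type*} [NormedRing A] [InnerProductSpace ℝ A] [SMulCommClass ℝ A A] {n : ℕ}

/-- The action of `n × n` matrices over `A` on the column vectors in `Aⁿ`. -/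
def mulVecRep : Representation ℝ (Matrix (Fin n) (Fin n) A) (LinearSpaceOver A n) where
  toFun B :=
    { toFun := fun v => WithLp.toLp 2 (B *ᵥ WithLp.ofLp v)
      map_add' := fun _ _ => PiLp.ext <| congrFun (B.mulVec_add _ _)
      map_smul' := fun r _ => PiLp.ext <| congrFun (B.mulVec_smul r _) }
  map_one' := LinearMap.ext fun _ => PiLp.ext <| congrFun (Matrix.one_mulVec _)
  map_mul' B C := LinearMap.ext fun _ => PiLp.ext <| congrFun (Matrix.mulVec_mulVec _ B C).symm

theorem mulVecRep_apply (B : Matrix (Fin n) (Fin n) A) (v : LinearSpaceOver A n) :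
    mulVecRep B v = WithLp.toLp 2 (B *ᵥ WithLp.ofLp v) := rfl

theorem mulVecRep_injective : Function.Injective (mulVecRep (A := A) (n := n)) := fun _ _ h =>
  Matrix.mulVec_injective <| funext fun v =>
    congrArg WithLp.ofLp (LinearMap.congr_fun h (WithLp.toLp 2 v))

theorem mulVecRep_rightMul (B : Matrix (Fin n) (Fin n) A) (v : LinearSpaceOver A n) (x : A) :
    mulVecRep B (rightMul v x) = rightMul (mulVecRep B v) x := by
  ext i
  simp only [mulVecRep_apply, rightMul, Matrix.mulVec, dotProduct, Finset.sum_mul, mul_assoc]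

theorem mulVecRep_neg_one : mulVecRep (-1 : Matrix (Fin n) (Fin n) A) = -1 :=
  LinearMap.ext fun v => PiLp.ext fun i => by
    simp [mulVecRep_apply, Matrix.neg_mulVec]

variable [StarRing A] [StarAdjoint A]

theorem inner_mulVecRep_left (B : Matrix (Fin n) (Fin n) A) (u v : LinearSpaceOver A n) :
    inner ℝ (mulVecRep B u) v = inner ℝ u (mulVecRep Bᴴ v) := by
  simp only [mulVecRep_apply, PiLp.inner_apply, Matrix.mulVec, dotProduct, sum_inner, inner_sum,
    Matrix.conjTranspose_apply, StarAdjoint.inner_mul_left]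
  exact Finset.sum_comm

theorem norm_mulVecRep_of_mem_unitary {B : Matrix (Fin n) (Fin n) A} (hB : B ∈ unitary _)
    (v : LinearSpaceOver A n) : ‖mulVecRep B v‖ = ‖v‖ := by
  have hBB : Bᴴ * B = 1 := Unitary.star_mul_self_of_mem hB
  rw [← sq_eq_sq₀ (norm_nonneg _) (norm_nonneg _), ← real_inner_self_eq_norm_sq,
    ← real_inner_self_eq_norm_sq, inner_mulVecRep_left, ← Module.End.mul_apply, ← map_mul, hBB,
    map_one, Module.End.one_apply]

theorem mem_unitary_of_mulVecRep_eq_isometry {B : Matrix (Fin n) (Fin n) A}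
    {φ : LinearSpaceOver A n ≃ₗᵢ[ℝ] LinearSpaceOver A n} (hφ : ∀ v, mulVecRep B v = φ v) :
    B ∈ unitary _ := by
  have left_inv (v : LinearSpaceOver A n) : mulVecRep Bᴴ (φ v) = v :=
    ext_inner_left ℝ fun u => by
      rw [← inner_mulVecRep_left, hφ, φ.inner_map_map]
  refine Unitary.mem_iff.2 ⟨mulVecRep_injective ?_, mulVecRep_injective ?_⟩ <;>
    ext1 v <;> rw [map_mul, map_one, Module.End.mul_apply, Module.End.one_apply,
      Matrix.star_eq_conjTranspose]
  · rw [hφ, left_inv]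
  · obtain ⟨w, rfl⟩ := φ.surjective v
    rw [left_inv, hφ]

/-- The action of the unitary group over `A` on `Aⁿ` by linear isometries. -/
def unitaryAction : unitary (Matrix (Fin n) (Fin n) A) →*
    (LinearSpaceOver A n ≃ₗᵢ[ℝ] LinearSpaceOver A n) :=
  isometryRep (mulVecRep.comp (unitary _).subtype) fun B => norm_mulVecRep_of_mem_unitary B.2

theorem unitaryAction_injective : Function.Injective (unitaryAction (A := A) (n := n)) :=
  fun _ _ h => Subtype.ext <| mulVecRep_injective <| LinearMap.ext fun v => DFunLike.congr_fun h v

theorem mem_range_unitaryAction {φ : LinearSpaceOver A n ≃ₗᵢ[ℝ] LinearSpaceOver A n} :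
    φ ∈ (unitaryAction (A := A) (n := n)).range ↔
      ∀ v x, φ (rightMul v x) = rightMul (φ v) x := by
  constructor
  · rintro ⟨B, rfl⟩
    exact mulVecRep_rightMul B.1
  · intro hφ
    obtain ⟨B, hB⟩ := exists_mulVec_of_rightMul (φ : LinearSpaceOver A n →+ LinearSpaceOver A n) hφ
    have hBφ (v) : mulVecRep B v = φ v := (hB v).symm
    exact ⟨⟨B, mem_unitary_of_mulVecRep_eq_isometry hBφ⟩, LinearIsometryEquiv.ext hBφ⟩

variable [IsLeftCancelMulZero A] [Nontrivial A]

theorem range_unitaryAction (hA : ∀ θ ∈ specialOrthogonal A, θ 1 = 1 → θ = 1) :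
    (unitaryAction (A := A) (n := n)).range = twistedIso A n := by
  ext φ
  refine mem_range_unitaryAction.trans ⟨fun h => ⟨1, one_mem _, h⟩, ?_⟩
  rintro ⟨θ, hθ, h⟩ v x
  obtain rfl | hn := eq_or_ne n 0
  · exact Subsingleton.elim _ _
  have : NeZero n := ⟨hn⟩
  obtain ⟨w, i, hw⟩ := exists_isometry_apply_ne_zero φ
  rw [h, hA θ hθ (twist_map_one h hw), LinearIsometryEquiv.coe_one, id]

theorem exists_twistedIso_mulEquiv_unitary (hA : ∀ θ ∈ specialOrthogonal A, θ 1 = 1 → θ = 1)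
    (n : ℕ) :
    ∃ e : twistedIso A n ≃* unitary (Matrix (Fin n) (Fin n) A),
      ∀ (φ : twistedIso A n) (v : LinearSpaceOver A n),
        φ.1 v = WithLp.toLp 2 ((e φ).1 *ᵥ WithLp.ofLp v) := by
  let e := (MonoidHom.ofInjective unitaryAction_injective).trans
    (MulEquiv.subgroupCongr (range_unitaryAction (n := n) hA))
  exact ⟨e.symm, fun φ v => congrArg (fun ψ : twistedIso A n => ψ.1 v) (e.apply_symm_apply φ).symm⟩

theorem isometry_real_eq_one (θ : ℝ ≃ₗᵢ[ℝ] ℝ) (h : θ 1 = 1) : θ = 1 := by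
  ext x
  simpa [h] using θ.map_smul x 1

theorem rotation_complex_eq_one (θ : ℂ ≃ₗᵢ[ℝ] ℂ) (hθ : θ ∈ specialOrthogonal ℂ)
    (h : θ 1 = 1) : θ = 1 := by
  rcases linear_isometry_complex_aux h with rfl | rfl
  · rfl
  · have det_one : LinearMap.det (Complex.conjAe.toLinearEquiv : ℂ →ₗ[ℝ] ℂ) = 1 := hθ
    have det_neg_one : LinearMap.det (Complex.conjAe.toLinearEquiv : ℂ →ₗ[ℝ] ℂ) = -1 :=
      Complex.det_conjAe
    norm_num [det_neg_one] at det_one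

end UnitaryMatrices

section Intertwiners

variable {A R ι : Type*} [NormedRing A] [StarRing A] [InnerProductSpace ℝ A] [StarModule ℝ A]
  [StarAdjoint A] [Fintype ι] [Ring R] [Algebra ℝ R]

/-- The average of `w` over an orthonormal basis of `A`, with `A` acting on `R` from the left
through `f` and from the right through `g`. -/
def intertwiner (b : OrthonormalBasis ι ℝ A) (f g : A →ₗ[ℝ] R) (w : R) : R :=
  ∑ a, f (b a) * w * g (star (b a))

theorem mul_intertwiner (b : OrthonormalBasis ι ℝ A) {f g : A →ₗ[ℝ] R}
    (hf : ∀ x y, f (x * y) = f x * f y) (hg : ∀ x y, g (x * y) = g x * g y) (w : R) (x : A) :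
    f x * intertwiner b f g w = intertwiner b f g w * g x := by
  have expand_left (a : ι) : f x * f (b a) = ∑ c, inner ℝ (b c) (x * b a) • f (b c) := by
    rw [← hf, ← b.sum_repr' (x * b a), map_sum]
    simp only [map_smul, b.sum_repr']
  have expand_right (c : ι) :
      ∑ a, inner ℝ (b c) (x * b a) • g (star (b a)) = g (star (b c)) * g x := by
    simp only [real_inner_comm (x * _), StarAdjoint.inner_mul_left]
    rw [← hg, ← star_star x, ← star_mul, star_star, ← b.sum_repr' (star x * b c), star_sum, map_sum]
    simp only [star_smul, star_trivial, map_smul, b.sum_repr']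
  calc f x * intertwiner b f g w
      = ∑ a, ∑ c, inner ℝ (b c) (x * b a) • (f (b c) * w * g (star (b a))) := by
        simp only [intertwiner, Finset.mul_sum, ← mul_assoc, expand_left, Finset.sum_mul,
          smul_mul_assoc]
    _ = ∑ c, f (b c) * w * ∑ a, inner ℝ (b c) (x * b a) • g (star (b a)) := by
        rw [Finset.sum_comm]
        simp only [Finset.mul_sum, mul_smul_comm]
    _ = intertwiner b f g w * g x := by
        simp only [expand_right, intertwiner, Finset.sum_mul, mul_assoc]

end Intertwiners

section Quaternions

instance : StarModule ℝ ℍ[ℝ] := ⟨Quaternion.star_smul⟩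

theorem quaternion_eq_coe_re_of_commute {q : ℍ[ℝ]} (h : ∀ x, q * x = x * q) : q = q.re := by
  obtain ⟨i, hi⟩ := (Quaternion.equivTuple ℝ).surjective ![0, 1, 0, 0]
  obtain ⟨j, hj⟩ := (Quaternion.equivTuple ℝ).surjective ![0, 0, 1, 0]
  simp only [Quaternion.equivTuple_apply, Matrix.vecCons_inj] at hi hj
  have imI_eq := congrArg (fun y : ℍ[ℝ] => y.imK) (h j)
  have imJ_eq := congrArg (fun y : ℍ[ℝ] => y.imK) (h i)
  have imK_eq := congrArg (fun y : ℍ[ℝ] => y.imJ) (h i)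
  simp only [Quaternion.imK_mul, Quaternion.imJ_mul, hi, hj] at imI_eq imJ_eq imK_eq
  ext <;> simp only [Quaternion.re_coe, Quaternion.imI_coe, Quaternion.imJ_coe,
    Quaternion.imK_coe] <;> linarith

theorem eq_one_or_eq_neg_one_of_commute {q : ℍ[ℝ]} (hq : q ∈ unitary ℍ[ℝ])
    (h : ∀ x, q * x = x * q) : q = 1 ∨ q = -1 := by
  have hre := quaternion_eq_coe_re_of_commute h
  have norm_re : |q.re| = 1 := by
    rw [← Real.norm_eq_abs, ← Quaternion.norm_coe, ← hre, CStarRing.norm_of_mem_unitary hq]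
  rcases eq_or_eq_neg_of_abs_eq norm_re with h1 | h1 <;> rw [h1] at hre
  · exact .inl (by simpa using hre)
  · exact .inr (by simpa using hre)

theorem quaternion_re_mul_comm (x y : ℍ[ℝ]) : (x * y).re = (y * x).re := by
  simp only [Quaternion.re_mul]
  ring

/-- `1, i, j, k`. -/
def quaternionBasis : OrthonormalBasis (Fin 4) ℝ ℍ[ℝ] :=
  .ofRepr Quaternion.linearIsometryEquivTuple

theorem sum_basis_mul_mul_star (y : ℍ[ℝ]) :
    ∑ a, quaternionBasis a * y * star (quaternionBasis a) = (4 * y.re : ℝ) := by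
  have central (x : ℍ[ℝ]) := mul_intertwiner quaternionBasis (f := .id) (g := .id)
    (fun _ _ => rfl) (fun _ _ => rfl) y x
  simp only [LinearMap.id_apply] at central
  refine (quaternion_eq_coe_re_of_commute fun x => (central x).symm).trans ?_
  have unit (a) : star (quaternionBasis a) * quaternionBasis a = 1 := by
    rw [Quaternion.star_mul_self, Quaternion.normSq_eq_norm_mul_self, quaternionBasis.norm_eq_one]
    simp
  have summand (a) : (quaternionBasis a * y * star (quaternionBasis a)).re = y.re := by
    rw [quaternion_re_mul_comm, ← mul_assoc, unit, one_mul]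
  have re_sum (f : Fin 4 → ℍ[ℝ]) : (∑ a, f a).re = ∑ a, (f a).re := by
    simp [Fin.sum_univ_four]
  simp only [intertwiner, LinearMap.id_apply, re_sum, summand]
  simp

theorem sum_basis_re_smul : ∑ a, (quaternionBasis a).re • quaternionBasis a = 1 := by
  have inner_one (a) : inner ℝ (quaternionBasis a) 1 = (quaternionBasis a).re := by
    rw [Quaternion.inner_def, star_one, mul_one]
  simpa only [inner_one] using quaternionBasis.sum_repr' 1

theorem exists_ne_zero_forall_mul_eq_mul {θ : ℍ[ℝ] →ₗ[ℝ] ℍ[ℝ]} (h1 : θ 1 = 1)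
    (hmul : ∀ x y, θ (x * y) = θ x * θ y) : ∃ p ≠ 0, ∀ x, θ x * p = p * x := by
  suffices ∃ w, intertwiner quaternionBasis θ .id w ≠ 0 by
    obtain ⟨w, hw⟩ := this
    exact ⟨_, hw, mul_intertwiner quaternionBasis hmul (g := .id) (fun _ _ => rfl) w⟩
  by_contra! h
  have four_eq_zero : (4 : ℝ) • (1 : ℍ[ℝ]) = 0 := by
    calc (4 : ℝ) • (1 : ℍ[ℝ])
      _ = ∑ a, θ (quaternionBasis a) * ((4 * (quaternionBasis a).re : ℝ)) := by
          rw [← h1, ← sum_basis_re_smul, map_sum, Finset.smul_sum]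
          simp only [map_smul, smul_smul, Quaternion.mul_coe_eq_smul]
      _ = ∑ a, θ (quaternionBasis a) * ∑ c, quaternionBasis c * star (quaternionBasis a) *
            star (quaternionBasis c) := by
          simp only [sum_basis_mul_mul_star, Quaternion.re_star]
      _ = ∑ c, intertwiner quaternionBasis θ .id (quaternionBasis c) *
            star (quaternionBasis c) := by
          simp only [intertwiner, Finset.mul_sum, Finset.sum_mul, ← mul_assoc, LinearMap.id_apply]
          exact Finset.sum_comm
      _ = 0 := by simp only [h, zero_mul, Finset.sum_const_zero]
  simp at four_eq_zero

theorem exists_unitary_conj_of_isometry {θ : ℍ[ℝ] ≃ₗᵢ[ℝ] ℍ[ℝ]} (h1 : θ 1 = 1)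
    (hmul : ∀ x y, θ (x * y) = θ x * θ y) :
    ∃ q ∈ unitary ℍ[ℝ], ∀ x, θ x * q = q * x := by
  obtain ⟨p, hp, h⟩ := exists_ne_zero_forall_mul_eq_mul (θ := θ.toLinearEquiv) h1 hmul
  have hp' : ‖p‖ ≠ 0 := norm_ne_zero_iff.2 hp
  refine ⟨‖p‖⁻¹ • p, ?_, fun x => ?_⟩
  · have unit : Quaternion.normSq (‖p‖⁻¹ • p) = 1 := by
      rw [Quaternion.normSq_eq_norm_mul_self, norm_smul, norm_inv, norm_norm,
        inv_mul_cancel₀ hp', one_mul]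
    rw [Unitary.mem_iff, Quaternion.star_mul_self, Quaternion.self_mul_star, unit]
    exact ⟨Quaternion.coe_one, Quaternion.coe_one⟩
  · rw [mul_smul_comm, smul_mul_assoc]
    exact congrArg _ (h x)

/-- The rotation `x ↦ q x q⁻¹` of the quaternions by a unit quaternion `q`. -/
def quaternionConj (q : unitQuaternion) : ℍ[ℝ] ≃ₗᵢ[ℝ] ℍ[ℝ] :=
  ⟨(Unitary.conjStarAlgAut ℝ ℍ[ℝ] q).toAlgEquiv.toLinearEquiv, fun x => by
    change ‖(q : ℍ[ℝ]) * x * star q.1‖ = ‖x‖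
    rw [norm_mul, norm_mul, norm_star, CStarRing.norm_of_mem_unitary q.2, one_mul, mul_one]⟩

theorem mem_specialOrthogonal_of_det_nonneg {E : Type*} [NormedAddCommGroup E]
    [InnerProductSpace ℝ E] [FiniteDimensional ℝ E] (θ : E ≃ₗᵢ[ℝ] E)
    (h : 0 ≤ LinearMap.det (θ.toLinearEquiv : E →ₗ[ℝ] E)) : θ ∈ specialOrthogonal E := by
  change LinearMap.det (θ.toLinearEquiv : E →ₗ[ℝ] E) = 1
  rw [← abs_of_nonneg h, ← LinearMap.normDet_eq_abs_det]
  exact θ.toLinearIsometry.normDet_eq_one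

theorem quaternionConj_mem_specialOrthogonal (q : unitQuaternion) :
    quaternionConj q ∈ specialOrthogonal ℍ[ℝ] := by
  apply mem_specialOrthogonal_of_det_nonneg
  let conj : ℍ[ℝ] ≃ₗ[ℝ] ℍ[ℝ] := (starL' ℝ : ℍ[ℝ] ≃L[ℝ] ℍ[ℝ]).toLinearEquiv
  have factor : ((quaternionConj q).toLinearEquiv : ℍ[ℝ] →ₗ[ℝ] ℍ[ℝ]) =
      LinearMap.mulLeft ℝ q.1 ∘ₗ (conj ∘ₗ LinearMap.mulLeft ℝ q.1 ∘ₗ conj.symm) := by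
    ext1 x
    change q * x * star q.1 = q * star (q * star x)
    rw [star_mul, star_star, mul_assoc]
  rw [factor, LinearMap.det_comp, LinearMap.det_conj]
  exact mul_self_nonneg _

end Quaternions

section Symplectic

variable {A : Type*} [NormedRing A] [StarRing A] [CStarRing A] [InnerProductSpace ℝ A]
  [IsScalarTower ℝ A A] {n : ℕ}

/-- The action `v ↦ v q⁻¹` of the unitary elements `q` of `A` on `Aⁿ`. -/
def rightUnitaryAction : unitary A →* (LinearSpaceOver A n ≃ₗᵢ[ℝ] LinearSpaceOver A n) :=
  isometryRep
    { toFun q :=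
        { toFun v := rightMul v (star q.1)
          map_add' u v := PiLp.ext fun i => add_mul (u i) (v i) _
          map_smul' r v := PiLp.ext fun i => smul_mul_assoc r (v i) _ }
      map_one' := LinearMap.ext fun v => PiLp.ext fun i => by
        change v i * star (1 : A) = v i
        rw [star_one, mul_one]
      map_mul' p q := LinearMap.ext fun v => PiLp.ext fun i => by
        change v i * star (p * q : A) = v i * star q.1 * star p.1
        rw [star_mul, mul_assoc] }
    fun q v => by
      rw [PiLp.norm_eq_of_L2, PiLp.norm_eq_of_L2]
      congr! 3 with i
      exact CStarRing.norm_mul_coe_unitary (v i) (star q)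

variable [SMulCommClass ℝ A A] [StarAdjoint A]

theorem commute_unitaryAction_rightUnitaryAction (B : unitary (Matrix (Fin n) (Fin n) A))
    (q : unitary A) : Commute (unitaryAction B) (rightUnitaryAction q) :=
  LinearIsometryEquiv.ext fun v => mulVecRep_rightMul B.1 v (star q.1)

/-- The action `v ↦ B v q⁻¹` of the pairs `(B, q)` of a unitary matrix and a unitary element. -/
def biunitaryAction : unitary (Matrix (Fin n) (Fin n) A) × unitary A →*
    (LinearSpaceOver A n ≃ₗᵢ[ℝ] LinearSpaceOver A n) :=
  unitaryAction.noncommCoprod rightUnitaryAction commute_unitaryAction_rightUnitaryAction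

theorem biunitaryAction_apply (B : unitary (Matrix (Fin n) (Fin n) A)) (q : unitary A)
    (v : LinearSpaceOver A n) :
    biunitaryAction (B, q) v = rightMul (mulVecRep B.1 v) (star q.1) :=
  mulVecRep_rightMul B.1 v (star q.1)

theorem biunitaryAction_rightMul (B : unitary (Matrix (Fin n) (Fin n) A)) (q : unitary A)
    (v : LinearSpaceOver A n) (x : A) :
    biunitaryAction (B, q) (rightMul v x) =
      rightMul (biunitaryAction (B, q) v) (q * x * star q.1) := by
  simp only [biunitaryAction_apply, mulVecRep_rightMul, ← rightMul_mul, ← mul_assoc,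
    Unitary.star_mul_self_of_mem q.2, one_mul]

theorem range_biunitaryAction_quaternion :
    (biunitaryAction (A := ℍ[ℝ]) (n := n)).range = twistedIso ℍ[ℝ] n := by
  ext φ
  constructor
  · rintro ⟨⟨B, q⟩, rfl⟩
    exact ⟨quaternionConj q, quaternionConj_mem_specialOrthogonal q, biunitaryAction_rightMul B q⟩
  · rintro ⟨θ, -, h⟩
    obtain rfl | hn := eq_or_ne n 0
    · exact ⟨1, LinearIsometryEquiv.ext fun _ => Subsingleton.elim _ _⟩
    have : NeZero n := ⟨hn⟩
    obtain ⟨w, i, hw⟩ := exists_isometry_apply_ne_zero φ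
    obtain ⟨q, hq, hθ⟩ :=
      exists_unitary_conj_of_isometry (twist_map_one h hw) (twist_map_mul h hw)
    have untwisted : rightUnitaryAction ⟨q, hq⟩⁻¹ * φ ∈ unitaryAction.range := by
      refine mem_range_unitaryAction.2 fun v x => ?_
      change rightMul (φ (rightMul v x)) (star (star q)) =
        rightMul (rightMul (φ v) (star (star q))) x
      rw [star_star, h, ← rightMul_mul, ← rightMul_mul, hθ]
    obtain ⟨B, hB⟩ := untwisted
    refine ⟨(B, ⟨q, hq⟩), ?_⟩
    rw [biunitaryAction, MonoidHom.noncommCoprod_apply', hB, map_inv, mul_inv_cancel_left]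

theorem mem_ker_biunitaryAction_quaternion [NeZero n]
    (B : unitary (Matrix (Fin n) (Fin n) ℍ[ℝ])) (q : unitary ℍ[ℝ]) :
    (B, q) ∈ (biunitaryAction (A := ℍ[ℝ]) (n := n)).ker ↔
      (B.1 = 1 ∧ q.1 = 1) ∨ (B.1 = -1 ∧ q.1 = -1) := by
  rw [MonoidHom.mem_ker]
  constructor
  · intro trivial_action
    obtain ⟨v, i, hv⟩ := exists_isometry_apply_ne_zero (1 : LinearSpaceOver ℍ[ℝ] n ≃ₗᵢ[ℝ] _)
    have conj_eq (x : ℍ[ℝ]) : q.1 * x * star q.1 = x := rightMul_injective hv <| by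
      simpa only [trivial_action, LinearIsometryEquiv.coe_one, id] using
        (biunitaryAction_rightMul B q v x).symm
    have central (x : ℍ[ℝ]) : q.1 * x = x * q.1 := by
      conv_rhs => rw [← conj_eq x, mul_assoc, Unitary.star_mul_self_of_mem q.2, mul_one]
    have fixed (w : LinearSpaceOver ℍ[ℝ] n) : rightMul (mulVecRep B.1 w) (star q.1) = w := by
      rw [← biunitaryAction_apply, trivial_action, LinearIsometryEquiv.coe_one, id]
    refine (eq_one_or_eq_neg_one_of_commute q.2 central).imp (fun hq => ⟨?_, hq⟩)
      (fun hq => ⟨?_, hq⟩) <;> refine mulVecRep_injective <| LinearMap.ext fun w => ?_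
    · rw [map_one, Module.End.one_apply]
      simpa only [hq, star_one, rightMul_one] using fixed w
    · rw [mulVecRep_neg_one, LinearMap.neg_apply, Module.End.one_apply, ← neg_eq_iff_eq_neg,
        ← rightMul_neg_one, ← star_one, ← star_neg, ← hq, fixed]
  · rintro (⟨hB, hq⟩ | ⟨hB, hq⟩) <;> ext1 w <;>
      rw [biunitaryAction_apply, hB, hq, LinearIsometryEquiv.coe_one, id]
    · rw [map_one, star_one, rightMul_one, Module.End.one_apply]
    · rw [mulVecRep_neg_one, LinearMap.neg_apply, Module.End.one_apply, star_neg, star_one,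
        rightMul_neg_one, neg_neg]

theorem star_eq_inv_of_mem_unitary {R : Type*} [DivisionRing R] [StarMul R] {q : R}
    (hq : q ∈ unitary R) : star q = q⁻¹ :=
  eq_inv_of_mul_eq_one_left (Unitary.star_mul_self_of_mem hq)

end Symplectic

section Exterior

variable {R M : Type*} [CommRing R] [AddCommGroup M] [Module R M]

open ExteriorAlgebra in
theorem exteriorMap_id_sub_smulRight (d : Module.Dual R M) (e : M) (x : ExteriorAlgebra R M) :
    map (LinearMap.id - d.smulRight e) x = x - ι R e * CliffordAlgebra.contractLeft d x := by
  induction x using CliffordAlgebra.left_induction with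
  | algebraMap r =>
    rw [AlgHom.commutes, CliffordAlgebra.contractLeft_algebraMap, mul_zero, sub_zero]
  | add x y hx hy => rw [map_add, hx, hy, map_add, mul_add, add_sub_add_comm]
  | ι_mul x v hx =>
    have swap : ι R v * ι R e = -(ι R e * ι R v) :=
      eq_neg_of_add_eq_zero_left (ι_add_mul_swap v e)
    have square : ι R e * ι R e = 0 := ι_sq_zero e
    rw [map_mul, map_apply_ι, hx, CliffordAlgebra.contractLeft_ι_mul]
    simp only [LinearMap.sub_apply, LinearMap.id_apply, LinearMap.smulRight_apply, map_sub,
      map_smul, mul_sub, sub_mul, smul_mul_assoc, mul_smul_comm]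
    simp only [← mul_assoc, swap, square, neg_mul, zero_mul, smul_zero]
    abel

theorem id_sub_sum_insert_smulRight {κ : Type*} [DecidableEq κ] (b : Module.Basis κ R M)
    {s : Finset κ} {j : κ} (hj : j ∉ s) :
    LinearMap.id - ∑ i ∈ insert j s, (b.coord i).smulRight (b i) =
      (LinearMap.id - (b.coord j).smulRight (b j)) ∘ₗ
        (LinearMap.id - ∑ i ∈ s, (b.coord i).smulRight (b i)) := by
  have coord_sum (v : M) : b.coord j (∑ i ∈ s, b.coord i v • b i) = 0 := by
    rw [map_sum]
    refine Finset.sum_eq_zero fun i hi => ?_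
    rw [map_smul, b.coord_apply (i := j), b.repr_self,
      Finsupp.single_eq_of_ne (ne_of_mem_of_not_mem hi hj).symm, smul_zero]
  refine LinearMap.ext fun v => ?_
  simp only [Finset.sum_insert hj, LinearMap.sub_apply, LinearMap.add_apply,
    LinearMap.comp_apply, LinearMap.id_apply, LinearMap.sum_apply,
    LinearMap.smulRight_apply, map_sub, coord_sum, zero_smul, sub_zero]
  abel

-- Killing the basis vectors one at a time deforms `map id` into `map 0`, the projection onto the
-- scalars, without changing `x`.
open ExteriorAlgebra in
theorem mem_range_algebraMap_of_contractLeft_eq_zero {κ : Type*} [Finite κ]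
    (b : Module.Basis κ R M) {x : ExteriorAlgebra R M}
    (hx : ∀ d : Module.Dual R M, CliffordAlgebra.contractLeft d x = 0) :
    x ∈ Set.range (algebraMap R (ExteriorAlgebra R M)) := by
  have := Fintype.ofFinite κ
  classical
  have fixed (s : Finset κ) :
      map (LinearMap.id - ∑ i ∈ s, (b.coord i).smulRight (b i)) x = x := by
    induction s using Finset.induction with
    | empty => rw [Finset.sum_empty, sub_zero, map_id, AlgHom.id_apply]
    | insert j s hj ih =>
      rw [id_sub_sum_insert_smulRight b hj, ← map_comp_map, AlgHom.comp_apply, ih,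
        exteriorMap_id_sub_smulRight, hx, mul_zero, sub_zero]
  have expand : ∑ i, (b.coord i).smulRight (b i) = LinearMap.id :=
    LinearMap.ext fun v => by
      simp only [LinearMap.sum_apply, LinearMap.smulRight_apply, b.coord_apply, b.sum_repr,
        LinearMap.id_apply]
  have map_zero_eq : map (0 : M →ₗ[R] M) = (Algebra.ofId R _).comp algebraMapInv := by
    ext v
    simp [algebraMapInv]
  refine ⟨algebraMapInv x, ?_⟩
  rw [← fixed Finset.univ, expand, sub_self, map_zero_eq]
  simp

end Exterior

section Clifford

open CliffordAlgebra

variable {R M : Type*} [CommRing R] [AddCommGroup M] [Module R M] {Q : QuadraticForm R M}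

theorem ι_mul_sub_involute_mul_ι (v : M) (x : CliffordAlgebra Q) :
    ι Q v * x - involute x * ι Q v = contractLeft (QuadraticMap.polarBilin Q v) x := by
  induction x using CliffordAlgebra.left_induction with
  | algebraMap r =>
    rw [AlgHom.commutes, contractLeft_algebraMap, Algebra.commutes, sub_self]
  | add x y hx hy => rw [map_add, map_add, mul_add, add_mul, add_sub_add_comm, hx, hy]
  | ι_mul x w hx =>
    rw [contractLeft_ι_mul, ← hx, map_mul, involute_ι, QuadraticMap.polarBilin_apply_apply,
      Algebra.smul_def, ← ι_mul_ι_add_swap]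
    noncomm_ring

theorem mem_range_algebraMap_of_commute_ι [Invertible (2 : R)] {κ : Type*} [Finite κ]
    (b : Module.Basis κ R M)
    (hQ : Function.Surjective (QuadraticMap.polarBilin Q)) {x : CliffordAlgebra Q}
    (hx : involute x = x) (hcomm : ∀ v, ι Q v * x = x * ι Q v) :
    x ∈ Set.range (algebraMap R (CliffordAlgebra Q)) := by
  have contract (d : Module.Dual R M) : contractLeft d (equivExterior Q x) = 0 := by
    obtain ⟨v, rfl⟩ := hQ d
    rw [equivExterior, changeFormEquiv_apply, ← changeForm_contractLeft,
      ← ι_mul_sub_involute_mul_ι, hx, hcomm, sub_self, map_zero]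
  obtain ⟨r, hr⟩ := mem_range_algebraMap_of_contractLeft_eq_zero b contract
  refine ⟨r, (equivExterior Q).injective ?_⟩
  rw [← hr, equivExterior, changeFormEquiv_apply, changeForm_algebraMap]

theorem mem_even_of_involute_eq [Invertible (2 : R)] {x : CliffordAlgebra Q}
    (hx : involute x = x) : x ∈ even Q := by
  have mem_sup : x ∈ evenOdd Q 0 ⊔ evenOdd Q 1 := (evenOdd_isCompl Q).sup_eq_top ▸ trivial
  obtain ⟨a, ha, b, hb, rfl⟩ := Submodule.mem_sup.1 mem_sup
  rw [map_add, involute_eq_of_mem_even ha, involute_eq_of_mem_odd hb, add_right_inj] at hx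
  have two_b : b + b = 0 := neg_eq_iff_add_eq_zero.1 hx
  have hb0 : b = 0 := by
    rw [← invOf_smul_smul (2 : R) b, two_smul, two_b, smul_zero]
  rw [hb0, add_zero]
  exact ha

theorem neg_one_mem_spinGroup {u : M} (hu : Q u = 1) : -1 ∈ spinGroup Q := by
  have square : ι Q u * ι Q u = 1 := by rw [ι_sq_scalar, hu, map_one]
  let U : (CliffordAlgebra Q)ˣ := ⟨ι Q u, ι Q u, square, square⟩
  have hU : U ∈ lipschitzGroup Q := Subgroup.subset_closure ⟨u, rfl⟩
  have hU_neg : -U ∈ lipschitzGroup Q := Subgroup.subset_closure ⟨-u, map_neg _ u⟩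
  refine ⟨⟨⟨-U * U, mul_mem hU_neg hU, ?_⟩, ?_⟩, (even Q).neg_mem (one_mem _)⟩
  · change -ι Q u * ι Q u = -1
    rw [neg_mul, square]
  · change -1 ∈ unitary (CliffordAlgebra Q)
    rw [Unitary.mem_iff, star_neg, star_one, neg_mul_neg, one_mul, and_self]

section NegEvenLift

variable {A : Type*} [Ring A] [Algebra R A] (f : M →ₗ[R] A)

/-- A linear map `f` with `f m ^ 2 = -Q m` does not extend to the Clifford algebra of `Q`, but its
even part does: this is the homomorphism of the even Clifford algebra with `m₁ m₂ ↦ -f m₁ f m₂`. -/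
def negEvenLift (hf : ∀ m, f m * f m = -algebraMap R A (Q m)) : even Q →ₐ[R] A :=
  even.lift Q
    { bilin := -(LinearMap.mul R A).compl₁₂ f f
      contract := fun m => by
        change -(f m * f m) = _
        rw [hf, neg_neg]
      contract_mid := fun m₁ m₂ m₃ => by
        change -(f m₁ * f m₂) * -(f m₂ * f m₃) = Q m₂ • -(f m₁ * f m₃)
        rw [neg_mul_neg, mul_assoc, ← mul_assoc (f m₂), hf, Algebra.smul_def, neg_mul, mul_neg,
          mul_neg, Algebra.left_comm] }

/-- The representation `m ↦ !![0, f m; -f m, 0]` of the Clifford algebra, which on the even part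
is `negEvenLift f` acting diagonally. -/
def doubledLift (hf : ∀ m, f m * f m = -algebraMap R A (Q m)) :
    CliffordAlgebra Q →ₐ[R] Matrix (Fin 2) (Fin 2) A :=
  lift Q ⟨{
    toFun m := !![0, f m; -f m, 0]
    map_add' m m' := by simp [add_comm]
    map_smul' r m := by simp }, fun m => by
      simp [hf, Matrix.algebraMap_eq_diagonal, ← Matrix.ext_iff, Fin.forall_fin_two]⟩

variable {f} (hf : ∀ m, f m * f m = -algebraMap R A (Q m))

include hf in
theorem injective_of_mul_self [FaithfulSMul R A] (hQ : Q.Anisotropic) :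
    Function.Injective f := by
  refine (injective_iff_map_eq_zero f).2 fun m hm => hQ m ?_
  have square := hf m
  rwa [hm, zero_mul, eq_comm, neg_eq_zero, FaithfulSMul.algebraMap_eq_zero_iff] at square

theorem doubledLift_ι (m : M) : doubledLift f hf (ι Q m) = !![0, f m; -f m, 0] :=
  lift_ι_apply ..

theorem doubledLift_even (x : even Q) :
    doubledLift f hf x = Matrix.scalar (Fin 2) (negEvenLift f hf x) := by
  have restrict_even : (doubledLift f hf).comp (even Q).val =
      (Matrix.scalarAlgHom (Fin 2) R).comp (negEvenLift f hf) := by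
    refine even.algHom_ext Q <| EvenHom.ext <| LinearMap.ext₂ fun m₁ m₂ => ?_
    change doubledLift f hf (ι Q m₁ * ι Q m₂) = Matrix.scalar (Fin 2) (negEvenLift f hf _)
    rw [map_mul, doubledLift_ι, doubledLift_ι, negEvenLift, even.lift_ι]
    ext i j
    fin_cases i <;> fin_cases j <;> simp
  exact DFunLike.congr_fun restrict_even x

theorem negEvenLift_mul_eq {x : even Q} {m m' : M} (h : x * ι Q m = ι Q m' * x) :
    negEvenLift f hf x * f m = f m' * negEvenLift f hf x := by
  simpa [doubledLift_ι, doubledLift_even] using congrArg (fun y => doubledLift f hf y 0 1) h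

variable [StarRing R] [TrivialStar R] [StarRing A] [StarModule R A]

theorem doubledLift_reverse (hstar : ∀ m, star (f m) = -f m) (x : CliffordAlgebra Q) :
    doubledLift f hf (reverse x) = star (doubledLift f hf x) := by
  induction x using CliffordAlgebra.induction with
  | algebraMap r =>
    rw [reverse.commutes, AlgHom.commutes, ← algebraMap_star_comm, star_trivial]
  | ι m =>
    rw [reverse_ι, doubledLift_ι, Matrix.star_eq_conjTranspose]
    ext i j
    fin_cases i <;> fin_cases j <;> simp [hstar]
  | mul x y hx hy => rw [reverse.map_mul, map_mul, map_mul, star_mul, hx, hy]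
  | add x y hx hy => rw [map_add, map_add, map_add, star_add, hx, hy]

theorem star_negEvenLift_mul_self (hstar : ∀ m, star (f m) = -f m) {x : even Q}
    (hx : (x : CliffordAlgebra Q) ∈ spinGroup Q) :
    star (negEvenLift f hf x) * negEvenLift f hf x = 1 := by
  have reverse_mul : reverse (x : CliffordAlgebra Q) * x = 1 := by
    rw [← spinGroup.star_mul_self_of_mem hx, star_def, spinGroup.involute_eq hx]
  simpa [doubledLift_reverse hf hstar, doubledLift_even, Matrix.star_eq_conjTranspose] using
    congrArg (fun y => doubledLift f hf y 0 0) reverse_mul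

end NegEvenLift

end Clifford

section Pin

open CliffordAlgebra

variable {V E : Type*} [AddCommGroup V] [Module ℝ V] {Q : QuadraticForm ℝ V}
  [NormedAddCommGroup E] [InnerProductSpace ℝ E]

theorem reflection_orthogonal_span_singleton_apply (u v : E) :
    (ℝ ∙ u)ᗮ.reflection v = v - (2 * inner ℝ u v / ‖u‖ ^ 2) • u := by
  rw [Submodule.reflection_orthogonal_apply, Submodule.reflection_singleton_apply, neg_sub,
    mul_div_assoc, mul_smul, two_smul, two_smul]
  rfl

/-- The pairs `(g, η)` in which `η` is the isometry of `E ≅ V` given by the twisted conjugation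
`v ↦ involute g * v * g⁻¹` and `g` is even or odd according to the sign of `det η`. -/
def twistedConjPairs (Q : QuadraticForm ℝ V) (j : E ≃ₗ[ℝ] V) :
    Subgroup ((CliffordAlgebra Q)ˣ × (E ≃ₗᵢ[ℝ] E)) where
  carrier := {p | involute (p.1 : CliffordAlgebra Q) =
      LinearMap.det (p.2.toLinearEquiv : E →ₗ[ℝ] E) • (p.1 : CliffordAlgebra Q) ∧
    ∀ v, involute (p.1 : CliffordAlgebra Q) * ι Q (j v) = ι Q (j (p.2 v)) * p.1}
  one_mem' := by
    refine ⟨?_, fun v => ?_⟩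
    · change involute 1 = LinearMap.det LinearMap.id • (1 : CliffordAlgebra Q)
      rw [map_one, LinearMap.det_id, one_smul]
    · change involute 1 * ι Q (j v) = ι Q (j v) * 1
      rw [map_one, one_mul, mul_one]
  mul_mem' := by
    rintro ⟨g, η⟩ ⟨h, ξ⟩ ⟨hg, hη⟩ ⟨hh, hξ⟩
    refine ⟨?_, fun v => ?_⟩
    · change involute (g * h : CliffordAlgebra Q) =
        LinearMap.det ((η.toLinearEquiv : E →ₗ[ℝ] E) ∘ₗ (ξ.toLinearEquiv : E →ₗ[ℝ] E)) •
          (g * h : CliffordAlgebra Q)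
      rw [map_mul, hg, hh, LinearMap.det_comp, smul_mul_smul_comm]
    · change involute (g * h : CliffordAlgebra Q) * ι Q (j v) = ι Q (j (η (ξ v))) * (g * h)
      rw [map_mul, mul_assoc, hξ, ← mul_assoc, hη, mul_assoc]
  inv_mem' := by
    rintro ⟨g, η⟩ ⟨hg, hη⟩
    have cancel : involute (↑g⁻¹ : CliffordAlgebra Q) * involute (g : CliffordAlgebra Q) = 1 := by
      rw [← map_mul, Units.inv_mul, map_one]
    refine ⟨?_, fun v => ?_⟩
    · change involute (↑g⁻¹ : CliffordAlgebra Q) =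
        LinearMap.det (η.toLinearEquiv.symm : E →ₗ[ℝ] E) • (↑g⁻¹ : CliffordAlgebra Q)
      calc involute (↑g⁻¹ : CliffordAlgebra Q)
        _ = (LinearMap.det (η.toLinearEquiv.symm : E →ₗ[ℝ] E) *
              LinearMap.det (η.toLinearEquiv : E →ₗ[ℝ] E)) •
            involute (↑g⁻¹ : CliffordAlgebra Q) * (g * ↑g⁻¹) := by
          rw [LinearEquiv.det_symm_mul_det, one_smul, Units.mul_inv, mul_one]
        _ = LinearMap.det (η.toLinearEquiv.symm : E →ₗ[ℝ] E) •
            (involute (↑g⁻¹ : CliffordAlgebra Q) * involute (g : CliffordAlgebra Q) * ↑g⁻¹) := by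
          rw [hg, mul_smul, smul_mul_assoc, smul_mul_assoc, mul_smul_comm, smul_mul_assoc,
            mul_assoc]
        _ = _ := by rw [cancel, one_mul]
    · change involute (↑g⁻¹ : CliffordAlgebra Q) * ι Q (j v) = ι Q (j (η.symm v)) * ↑g⁻¹
      have conj_v : involute (g : CliffordAlgebra Q) * ι Q (j (η.symm v)) = ι Q (j v) * g :=
        (hη _).trans (by rw [η.apply_symm_apply])
      rw [Units.eq_mul_inv_iff_mul_eq, mul_assoc, ← conj_v, ← mul_assoc, cancel, one_mul]

variable {j : E ≃ₗ[ℝ] V} (hj : ∀ v, Q (j v) = ‖v‖ ^ 2)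
include hj

theorem anisotropic_of_eq_norm_sq : Q.Anisotropic := fun m hm => by
  obtain ⟨v, rfl⟩ := j.surjective m
  rw [hj, sq_eq_zero_iff, norm_eq_zero] at hm
  rw [hm, map_zero]

theorem polar_eq_two_mul_inner (v w : E) :
    QuadraticMap.polar Q (j v) (j w) = 2 * inner ℝ v w := by
  rw [QuadraticMap.polar, ← map_add, hj, hj, hj, norm_add_sq_real]
  ring

variable [FiniteDimensional ℝ E]

theorem surjective_polarBilin : Function.Surjective Q.polarBilin := fun f => by
  refine ⟨(2 : ℝ)⁻¹ • j ((InnerProductSpace.toDual ℝ E).symm (f ∘ₗ j).toContinuousLinearMap), ?_⟩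
  ext m
  obtain ⟨v, rfl⟩ := j.surjective m
  rw [map_smul, LinearMap.smul_apply, QuadraticMap.polarBilin_apply_apply,
    polar_eq_two_mul_inner hj, InnerProductSpace.toDual_symm_apply, smul_eq_mul,
    inv_mul_cancel_left₀ two_ne_zero]
  rfl

theorem mem_twistedConjPairs_reflection {u : E} (hu : u ≠ 0) {g : (CliffordAlgebra Q)ˣ}
    (hg : (g : CliffordAlgebra Q) = ι Q (j u)) :
    (g, (ℝ ∙ u)ᗮ.reflection) ∈ twistedConjPairs Q j := by
  refine ⟨?_, fun v => ?_⟩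
  · have det_eq : LinearMap.det ((ℝ ∙ u)ᗮ.reflection.toLinearEquiv : E →ₗ[ℝ] E) = -1 := by
      refine (Submodule.det_reflection (K := (ℝ ∙ u)ᗮ)).trans ?_
      rw [Submodule.orthogonal_orthogonal, finrank_span_singleton hu, pow_one]
    change involute (g : CliffordAlgebra Q) = LinearMap.det _ • (g : CliffordAlgebra Q)
    rw [hg, involute_ι, det_eq, neg_one_smul]
  · change involute (g : CliffordAlgebra Q) * ι Q (j v) = ι Q (j ((ℝ ∙ u)ᗮ.reflection v)) * g
    have hu' : ‖u‖ ^ 2 ≠ 0 := pow_ne_zero 2 (norm_ne_zero_iff.2 hu)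
    rw [hg, involute_ι, reflection_orthogonal_span_singleton_apply, map_sub, map_smul, map_sub,
      map_smul, sub_mul, smul_mul_assoc, ι_sq_scalar, hj, Algebra.algebraMap_eq_smul_one, smul_smul,
      div_mul_cancel₀ _ hu', ← polar_eq_two_mul_inner hj, ← Algebra.algebraMap_eq_smul_one,
      ← ι_mul_ι_add_swap, neg_mul, sub_add_cancel_right]

theorem exists_isometry_of_mem_lipschitzGroup {g : (CliffordAlgebra Q)ˣ}
    (hg : g ∈ lipschitzGroup Q) :
    ∃ η : E ≃ₗᵢ[ℝ] E, (g, η) ∈ twistedConjPairs Q j := by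
  have le_map : lipschitzGroup Q ≤
      (twistedConjPairs Q j).map (MonoidHom.fst _ _) := by
    rw [lipschitzGroup, Subgroup.closure_le]
    rintro g ⟨m, hm⟩
    obtain ⟨u, rfl⟩ := j.surjective m
    refine ⟨(g, (ℝ ∙ u)ᗮ.reflection), mem_twistedConjPairs_reflection hj ?_ hm.symm, rfl⟩
    rintro rfl
    rw [map_zero, map_zero] at hm
    exact g.ne_zero hm.symm
  obtain ⟨⟨_, η⟩, hη, rfl⟩ := le_map hg
  exact ⟨η, hη⟩

theorem exists_mem_lipschitzGroup_of_isometry (η : E ≃ₗᵢ[ℝ] E) :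
    ∃ g ∈ lipschitzGroup Q, reverse (g : CliffordAlgebra Q) * g = 1 ∧
      (g, η) ∈ twistedConjPairs Q j := by
  obtain ⟨l, -, rfl⟩ := η.reflections_generate_dim
  induction l with
  | nil => exact ⟨1, one_mem _, by rw [Units.val_one, reverse.map_one, one_mul], one_mem _⟩
  | cons v l ih =>
    obtain ⟨g, hg, norm_g, hη⟩ := ih
    rw [List.map_cons, List.prod_cons]
    set η := (l.map fun v => (ℝ ∙ v)ᗮ.reflection).prod
    by_cases hv : v = 0
    · refine ⟨g, hg, norm_g, ?_⟩
      have reflection_zero : (ℝ ∙ v)ᗮ.reflection = 1 := by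
        ext1 w
        rw [reflection_orthogonal_span_singleton_apply, hv, smul_zero, sub_zero]
        rfl
      rwa [reflection_zero, one_mul]
    · let u := ‖v‖⁻¹ • v
      have span_u : ℝ ∙ u = ℝ ∙ v :=
        Submodule.span_singleton_smul_eq (inv_ne_zero (norm_ne_zero_iff.2 hv)).isUnit v
      have reflection_u : (ℝ ∙ v)ᗮ.reflection = (ℝ ∙ u)ᗮ.reflection := by simp only [span_u]
      have norm_u : ‖u‖ = 1 := norm_smul_inv_norm hv
      have square : ι Q (j u) * ι Q (j u) = 1 := by
        rw [ι_sq_scalar, hj, norm_u, one_pow, map_one]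
      let U : (CliffordAlgebra Q)ˣ := ⟨ι Q (j u), ι Q (j u), square, square⟩
      have hU := mem_twistedConjPairs_reflection hj (norm_ne_zero_iff.1 (norm_u ▸ one_ne_zero))
        (show (U : CliffordAlgebra Q) = ι Q (j u) from rfl)
      refine ⟨U * g, mul_mem (Subgroup.subset_closure ⟨j u, rfl⟩) hg, ?_, ?_⟩
      · rw [Units.val_mul, reverse.map_mul, reverse_ι, mul_assoc, ← mul_assoc (ι Q (j u)), square,
          one_mul, norm_g]
      · rw [reflection_u]
        exact mul_mem hU hη

theorem exists_rotation_of_mem_spinGroup {s : CliffordAlgebra Q} (hs : s ∈ spinGroup Q) :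
    ∃ η ∈ specialOrthogonal E, ∀ v, s * ι Q (j v) = ι Q (j (η v)) * s := by
  obtain ⟨g, hg, rfl⟩ := pinGroup.mem_lipschitzGroup (spinGroup.mem_pin hs)
  obtain ⟨η, parity, hη⟩ := exists_isometry_of_mem_lipschitzGroup hj hg
  have even_g : involute (g : CliffordAlgebra Q) = g := spinGroup.involute_eq hs
  change ∃ η ∈ specialOrthogonal E, ∀ v, g * ι Q (j v) = ι Q (j (η v)) * g
  refine ⟨η, ?_, fun v => ?_⟩
  · exact smul_left_injective ℝ g.ne_zero
      (parity.symm.trans (even_g.trans (one_smul ℝ (g : CliffordAlgebra Q)).symm))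
  · simpa only [even_g] using hη v

theorem exists_mem_spinGroup_of_rotation {η : E ≃ₗᵢ[ℝ] E}
    (hη : η ∈ specialOrthogonal E) :
    ∃ s ∈ spinGroup Q, ∀ v, s * ι Q (j v) = ι Q (j (η v)) * s := by
  obtain ⟨g, hg, norm_g, parity, conj_g⟩ := exists_mem_lipschitzGroup_of_isometry hj η
  have even_g : involute (g : CliffordAlgebra Q) = g := by
    rw [parity, show LinearMap.det (η.toLinearEquiv : E →ₗ[ℝ] E) = 1 from hη, one_smul]
  have star_mul_g : star (g : CliffordAlgebra Q) * g = 1 := by rw [star_def, even_g, norm_g]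
  refine ⟨g, ⟨pinGroup.units_mem_iff.2 ⟨hg, star_mul_g, ?_⟩, mem_even_of_involute_eq even_g⟩,
    fun v => ?_⟩
  · rw [← Units.inv_eq_of_mul_eq_one_left star_mul_g, Units.mul_inv]
  · simpa only [even_g] using conj_g v

end Pin

section Extension

variable {F : Type*} [NormedAddCommGroup F] [InnerProductSpace ℝ F] [FiniteDimensional ℝ F]
  {K : Submodule ℝ F}

/-- The isometry of `F = K ⊕ Kᗮ` which is the identity on `K` and `η` on `Kᗮ`. -/
def extendOrthogonal (η : Kᗮ ≃ₗᵢ[ℝ] Kᗮ) : F ≃ₗᵢ[ℝ] F where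
  __ := ((K.prodEquivOfIsCompl Kᗮ K.isCompl_orthogonal).symm.trans
    ((LinearEquiv.refl ℝ K).prodCongr η.toLinearEquiv)).trans
      (K.prodEquivOfIsCompl Kᗮ K.isCompl_orthogonal)
  norm_map' x := by
    obtain ⟨⟨k, u⟩, rfl⟩ := (K.prodEquivOfIsCompl Kᗮ K.isCompl_orthogonal).surjective x
    have pythagoras (w : Kᗮ) : ‖(k : F) + w‖ ^ 2 = ‖k‖ ^ 2 + ‖w‖ ^ 2 := by
      rw [norm_add_sq_real, K.inner_right_of_mem_orthogonal k.2 w.2, mul_zero, add_zero]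
      rfl
    rw [← sq_eq_sq₀ (norm_nonneg _) (norm_nonneg _)]
    simp [pythagoras]

theorem extendOrthogonal_apply (η : Kᗮ ≃ₗᵢ[ℝ] Kᗮ) (k : K) (u : Kᗮ) :
    extendOrthogonal η (k + u) = k + η u := by
  let decomposition := K.prodEquivOfIsCompl Kᗮ K.isCompl_orthogonal
  change decomposition ((LinearEquiv.refl ℝ K).prodCongr η.toLinearEquiv
    (decomposition.symm (decomposition (k, u)))) = _
  rw [decomposition.symm_apply_apply]
  rfl

theorem det_extendOrthogonal (η : Kᗮ ≃ₗᵢ[ℝ] Kᗮ) :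
    LinearMap.det ((extendOrthogonal η).toLinearEquiv : F →ₗ[ℝ] F) =
      LinearMap.det (η.toLinearEquiv : Kᗮ →ₗ[ℝ] Kᗮ) := by
  refine (LinearMap.det_conj (LinearMap.id.prodMap (η.toLinearEquiv : Kᗮ →ₗ[ℝ] Kᗮ))
    (K.prodEquivOfIsCompl Kᗮ K.isCompl_orthogonal)).trans ?_
  rw [LinearMap.det_prodMap, LinearMap.det_id, one_mul]

theorem extendOrthogonal_mem_specialOrthogonal {η : Kᗮ ≃ₗᵢ[ℝ] Kᗮ} :
    extendOrthogonal η ∈ specialOrthogonal F ↔ η ∈ specialOrthogonal Kᗮ := by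
  change LinearMap.det _ = 1 ↔ LinearMap.det _ = 1
  rw [det_extendOrthogonal]

theorem exists_eq_extendOrthogonal {θ : F ≃ₗᵢ[ℝ] F} (h : ∀ x ∈ K, θ x = x) :
    ∃ η : Kᗮ ≃ₗᵢ[ℝ] Kᗮ, θ = extendOrthogonal η := by
  have map_orthogonal (u : Kᗮ) : θ u ∈ Kᗮ := fun x hx => by
    rw [← h x hx, θ.inner_map_map, K.inner_right_of_mem_orthogonal hx u.2]
  let η : Kᗮ →ₗᵢ[ℝ] Kᗮ :=
    ⟨(θ.toLinearEquiv : F →ₗ[ℝ] F).restrict fun u hu => map_orthogonal ⟨u, hu⟩,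
      fun u => θ.norm_map u⟩
  refine ⟨η.toLinearIsometryEquiv rfl, ?_⟩
  ext1 x
  obtain ⟨k, hk, u, hu, rfl⟩ := K.exists_add_mem_mem_orthogonal x
  rw [map_add, h k hk]
  exact (extendOrthogonal_apply (η.toLinearIsometryEquiv rfl) ⟨k, hk⟩ ⟨u, hu⟩).symm

end Extension

section NormedPairing

variable {E F : Type*} [NormedAddCommGroup E] [InnerProductSpace ℝ E]
  [NormedAddCommGroup F] [InnerProductSpace ℝ F]
  {R : F →ₗ[ℝ] Module.End ℝ E} (hR : ∀ x v, ‖R x v‖ = ‖x‖ * ‖v‖)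
include hR

theorem inner_apply_add_inner_apply (x y : F) (v w : E) :
    inner ℝ (R x v) (R y w) + inner ℝ (R y v) (R x w) = 2 * inner ℝ x y * inner ℝ v w := by
  have inner_same (z : F) : inner ℝ (R z v) (R z w) = ‖z‖ ^ 2 * inner ℝ v w := by
    have polarize := norm_add_sq_real (R z v) (R z w)
    rw [← map_add, hR, hR, hR, mul_pow, norm_add_sq_real] at polarize
    linarith
  have expand := inner_same (x + y)
  rw [map_add, LinearMap.add_apply, LinearMap.add_apply, inner_add_left, inner_add_right,
    inner_add_right, inner_same, inner_same, norm_add_sq_real] at expand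
  linarith

variable {e : F} (he : R e = 1)
include he

theorem inner_apply_left_of_inner_eq_zero {u : F} (hu : inner ℝ e u = 0) (v w : E) :
    inner ℝ (R u v) w = -inner ℝ v (R u w) := by
  have skew := inner_apply_add_inner_apply hR e u v w
  rw [he, hu, mul_zero, zero_mul, Module.End.one_apply, Module.End.one_apply] at skew
  linarith

theorem mul_self_of_inner_eq_zero {u : F} (hu : inner ℝ e u = 0) :
    R u * R u = -algebraMap ℝ (Module.End ℝ E) (‖u‖ ^ 2) := by
  ext1 v
  refine ext_inner_right ℝ fun w => ?_
  have h := inner_apply_add_inner_apply hR u u v w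
  rw [Module.End.mul_apply, inner_apply_left_of_inner_eq_zero hR he hu, LinearMap.neg_apply,
    Module.algebraMap_end_apply, inner_neg_left, real_inner_smul_left,
    ← real_inner_self_eq_norm_sq u]
  linarith

theorem star_of_inner_eq_zero [FiniteDimensional ℝ E] {u : F} (hu : inner ℝ e u = 0) :
    star (R u) = -R u := by
  rw [LinearMap.star_eq_adjoint, eq_comm, LinearMap.eq_adjoint_iff]
  intro v w
  rw [LinearMap.neg_apply, inner_neg_left, inner_apply_left_of_inner_eq_zero hR he hu, neg_neg]

end NormedPairing

section SpinAction

open CliffordAlgebra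

variable {V E : Type*} [AddCommGroup V] [Module ℝ V] {Q : QuadraticForm ℝ V}
  [NormedAddCommGroup E] [InnerProductSpace ℝ E] [FiniteDimensional ℝ E]
  {f : V →ₗ[ℝ] Module.End ℝ E} (hf : ∀ m, f m * f m = -algebraMap ℝ (Module.End ℝ E) (Q m))
  (hstar : ∀ m, star (f m) = -f m)

variable (Q) in
/-- The inclusion of the spin group in the even Clifford algebra. -/
def spinToEven : spinGroup Q →* even Q where
  toFun s := ⟨s, spinGroup.mem_even s.2⟩
  map_one' := rfl
  map_mul' _ _ := rfl

/-- The isometric action of the spin group on a Clifford module with skew-adjoint generators. -/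
def spinAction : spinGroup Q →* (E ≃ₗᵢ[ℝ] E) :=
  isometryRep ((negEvenLift f hf : even Q →* Module.End ℝ E).comp (spinToEven Q)) fun s v => by
    have isometric : (negEvenLift f hf (spinToEven Q s)).adjoint *
        negEvenLift f hf (spinToEven Q s) = 1 := star_negEvenLift_mul_self hf hstar s.2
    rw [← sq_eq_sq₀ (norm_nonneg _) (norm_nonneg _), ← real_inner_self_eq_norm_sq,
      ← real_inner_self_eq_norm_sq, ← LinearMap.adjoint_inner_left]
    exact congrArg (inner ℝ · v) (LinearMap.congr_fun isometric v)

variable {H : Type*} [NormedAddCommGroup H] [InnerProductSpace ℝ H] [FiniteDimensional ℝ H]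
  {j : H ≃ₗ[ℝ] V} (hj : ∀ v, Q (j v) = ‖v‖ ^ 2)
include hj

theorem spinAction_injective [Nontrivial E] : Function.Injective (spinAction hf hstar) := by
  rw [injective_iff_map_eq_one]
  intro s hs
  have acts_trivially : negEvenLift f hf (spinToEven Q s) = 1 :=
    LinearMap.ext fun v => DFunLike.congr_fun hs v
  have commute_ι (m : V) : ι Q m * s = s * ι Q m := by
    obtain ⟨η, -, hη⟩ := exists_rotation_of_mem_spinGroup hj s.2
    obtain ⟨u, rfl⟩ := j.surjective m
    have fixed := negEvenLift_mul_eq hf (x := spinToEven Q s) (hη u)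
    rw [acts_trivially, one_mul, mul_one] at fixed
    rw [hη, ← injective_of_mul_self hf (anisotropic_of_eq_norm_sq hj) fixed]
  have : Module.Finite ℝ V := .equiv j
  obtain ⟨r, hr⟩ := mem_range_algebraMap_of_commute_ι (Module.finBasis ℝ V)
    (surjective_polarBilin hj) (spinGroup.involute_eq s.2) commute_ι
  have scalar : spinToEven Q s = algebraMap ℝ _ r := Subtype.ext hr.symm
  rw [scalar, AlgHom.commutes, map_eq_one_iff _ (algebraMap ℝ _).injective] at acts_trivially
  exact Subtype.ext (by rw [← hr, acts_trivially, map_one]; rfl)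

end SpinAction

section OrthogonalGenerators

variable {V E F : Type*} [AddCommGroup V] [Module ℝ V] [NormedAddCommGroup E]
  [InnerProductSpace ℝ E] [NormedAddCommGroup F] [InnerProductSpace ℝ F]
  {R : F →ₗ[ℝ] Module.End ℝ E} {e : F} {j : (ℝ ∙ e)ᗮ ≃ₗ[ℝ] V}

variable (R j) in
/-- The restriction to `eᗮ ≅ V` of a family of endomorphisms of `E` parametrised by `F`; when
`‖R x v‖ = ‖x‖ ‖v‖` and `R e = 1`, it makes `E` a Clifford module. -/
def orthogonalGenerators : V →ₗ[ℝ] Module.End ℝ E :=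
  R ∘ₗ (ℝ ∙ e)ᗮ.subtype ∘ₗ j.symm.toLinearMap

theorem orthogonalGenerators_apply (u : (ℝ ∙ e)ᗮ) : orthogonalGenerators R j (j u) = R u :=
  congrArg (fun w : (ℝ ∙ e)ᗮ => R w) (j.symm_apply_apply u)

theorem orthogonalGenerators_mul_self (hR : ∀ x v, ‖R x v‖ = ‖x‖ * ‖v‖) (he : R e = 1)
    {Q : QuadraticForm ℝ V} (hj : ∀ u, Q (j u) = ‖u‖ ^ 2) (m : V) :
    orthogonalGenerators R j m * orthogonalGenerators R j m =
      -algebraMap ℝ (Module.End ℝ E) (Q m) := by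
  obtain ⟨u, rfl⟩ := j.surjective m
  rw [orthogonalGenerators_apply, hj,
    mul_self_of_inner_eq_zero hR he (Submodule.mem_orthogonal_singleton_iff_inner_right.1 u.2)]
  rfl

theorem star_orthogonalGenerators [FiniteDimensional ℝ E]
    (hR : ∀ x v, ‖R x v‖ = ‖x‖ * ‖v‖) (he : R e = 1) (m : V) :
    star (orthogonalGenerators R j m) = -orthogonalGenerators R j m :=
  star_of_inner_eq_zero hR he
    (Submodule.mem_orthogonal_singleton_iff_inner_right.1 (j.symm m).2)

variable [FiniteDimensional ℝ F]

theorem mul_eq_extendOrthogonal_mul (he : R e = 1) {T : Module.End ℝ E}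
    {η : (ℝ ∙ e)ᗮ ≃ₗᵢ[ℝ] (ℝ ∙ e)ᗮ} (h : ∀ u : (ℝ ∙ e)ᗮ, T * R u = R (η u) * T) (x : F) :
    T * R x = R (extendOrthogonal η x) * T := by
  obtain ⟨k, hk, u, hu, rfl⟩ := (ℝ ∙ e).exists_add_mem_mem_orthogonal x
  obtain ⟨r, rfl⟩ := Submodule.mem_span_singleton.1 hk
  rw [extendOrthogonal_apply η ⟨r • e, hk⟩ ⟨u, hu⟩, map_add, map_add, mul_add, add_mul,
    h ⟨u, hu⟩, map_smul, he, mul_smul_comm, smul_mul_assoc, mul_one, one_mul]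

open CliffordAlgebra

variable {Q : QuadraticForm ℝ V}
  (hf : ∀ m, orthogonalGenerators R j m * orthogonalGenerators R j m =
    -algebraMap ℝ (Module.End ℝ E) (Q m))

theorem negEvenLift_mul_extendOrthogonal (he : R e = 1) (s : spinGroup Q)
    {η : (ℝ ∙ e)ᗮ ≃ₗᵢ[ℝ] (ℝ ∙ e)ᗮ} (h : ∀ u, s * ι Q (j u) = ι Q (j (η u)) * s) (x : F) :
    negEvenLift (orthogonalGenerators R j) hf (spinToEven Q s) * R x =
      R (extendOrthogonal η x) * negEvenLift (orthogonalGenerators R j) hf (spinToEven Q s) := by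
  refine mul_eq_extendOrthogonal_mul he (fun u => ?_) x
  rw [← orthogonalGenerators_apply (R := R) (j := j) u,
    ← orthogonalGenerators_apply (R := R) (j := j) (η u)]
  exact negEvenLift_mul_eq hf (x := spinToEven Q s) (h u)

theorem exists_rotation_negEvenLift_mul (he : R e = 1) (hj : ∀ u, Q (j u) = ‖u‖ ^ 2)
    (s : spinGroup Q) : ∃ θ ∈ specialOrthogonal F, ∀ x,
    negEvenLift (orthogonalGenerators R j) hf (spinToEven Q s) * R x =
      R (θ x) * negEvenLift (orthogonalGenerators R j) hf (spinToEven Q s) := by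
  obtain ⟨η, hη, h⟩ := exists_rotation_of_mem_spinGroup hj s.2
  exact ⟨extendOrthogonal η, extendOrthogonal_mem_specialOrthogonal.2 hη,
    negEvenLift_mul_extendOrthogonal hf he s h⟩

theorem exists_spinGroup_negEvenLift_mul (he : R e = 1) (hj : ∀ u, Q (j u) = ‖u‖ ^ 2)
    {θ : F ≃ₗᵢ[ℝ] F} (hθ : θ ∈ specialOrthogonal F) (hθe : θ e = e) : ∃ s : spinGroup Q, ∀ x,
    negEvenLift (orthogonalGenerators R j) hf (spinToEven Q s) * R x =
      R (θ x) * negEvenLift (orthogonalGenerators R j) hf (spinToEven Q s) := by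
  have fixes_span (x : F) (hx : x ∈ ℝ ∙ e) : θ x = x := by
    obtain ⟨r, rfl⟩ := Submodule.mem_span_singleton.1 hx
    rw [map_smul, hθe]
  obtain ⟨η, rfl⟩ := exists_eq_extendOrthogonal fixes_span
  obtain ⟨s, hs, h⟩ :=
    exists_mem_spinGroup_of_rotation hj (extendOrthogonal_mem_specialOrthogonal.1 hθ)
  exact ⟨⟨s, hs⟩, negEvenLift_mul_extendOrthogonal hf he ⟨s, hs⟩ h⟩

end OrthogonalGenerators

namespace Octonion

@[simp] theorem fst_mk (a b : ℍ[ℝ]) : (mk a b).fst = a := rfl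
@[simp] theorem snd_mk (a b : ℍ[ℝ]) : (mk a b).snd = b := rfl

@[ext] theorem ext {x y : Octonion} (h₁ : x.fst = y.fst) (h₂ : x.snd = y.snd) : x = y :=
  WithLp.ofLp_injective 2 (Prod.ext h₁ h₂)

@[simp] theorem fst_zero : (0 : Octonion).fst = 0 := rfl
@[simp] theorem snd_zero : (0 : Octonion).snd = 0 := rfl
@[simp] theorem fst_add (x y : Octonion) : (x + y).fst = x.fst + y.fst := rfl
@[simp] theorem snd_add (x y : Octonion) : (x + y).snd = x.snd + y.snd := rfl
@[simp] theorem fst_smul (r : ℝ) (x : Octonion) : (r • x).fst = r • x.fst := rfl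
@[simp] theorem snd_smul (r : ℝ) (x : Octonion) : (r • x).snd = r • x.snd := rfl

@[simp] theorem fst_mul (x y : Octonion) :
    (x * y).fst = x.fst * y.fst - y.snd * star x.snd := rfl

@[simp] theorem snd_mul (x y : Octonion) :
    (x * y).snd = star x.fst * y.snd + y.fst * x.snd := rfl

instance : One Octonion := ⟨mk 1 0⟩

@[simp] theorem fst_one : (1 : Octonion).fst = 1 := rfl
@[simp] theorem snd_one : (1 : Octonion).snd = 0 := rfl

-- Scoped, so that elsewhere the additive group of `Octonion` is still the normed one.
scoped instance : NonAssocRing Octonion where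
  __ := (inferInstance : AddCommGroup Octonion)
  left_distrib x y z := by
    ext1 <;> simp only [fst_mul, snd_mul, fst_add, snd_add, mul_add, add_mul] <;> abel
  right_distrib x y z := by
    ext1 <;> simp only [fst_mul, snd_mul, fst_add, snd_add, star_add, mul_add, add_mul] <;> abel
  zero_mul x := by ext1 <;> simp
  mul_zero x := by ext1 <;> simp
  one_mul x := by ext1 <;> simp
  mul_one x := by ext1 <;> simp

instance : IsScalarTower ℝ Octonion Octonion where
  smul_assoc r x y := by ext1 <;> simp [smul_sub]

instance : SMulCommClass ℝ Octonion Octonion where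
  smul_comm r x y := by ext1 <;> simp [smul_sub]

instance : Nontrivial Octonion :=
  ⟨0, 1, fun h => zero_ne_one (congrArg fst h)⟩

instance : FiniteDimensional ℝ Octonion :=
  inferInstanceAs (FiniteDimensional ℝ (WithLp 2 (ℍ[ℝ] × ℍ[ℝ])))

instance : Fact (Module.finrank ℝ Octonion = 7 + 1) where
  out := by
    have finrank_eq := (WithLp.linearEquiv 2 ℝ (ℍ[ℝ] × ℍ[ℝ])).finrank_eq
    rwa [Module.finrank_prod, Quaternion.finrank_eq_four] at finrank_eq

theorem norm_sq_eq (x : Octonion) :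
    ‖x‖ ^ 2 = Quaternion.normSq x.fst + Quaternion.normSq x.snd := by
  rw [Quaternion.normSq_eq_norm_mul_self, Quaternion.normSq_eq_norm_mul_self, ← sq, ← sq]
  exact WithLp.prod_norm_sq_eq_of_L2 x

protected theorem norm_mul (x y : Octonion) : ‖x * y‖ = ‖x‖ * ‖y‖ := by
  rw [← sq_eq_sq₀ (norm_nonneg _) (by positivity), mul_pow]
  simp only [norm_sq_eq, fst_mul, snd_mul, Quaternion.normSq_def', Quaternion.re_mul,
    Quaternion.imI_mul, Quaternion.imJ_mul, Quaternion.imK_mul, Quaternion.re_star,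
    Quaternion.imI_star, Quaternion.imJ_star, Quaternion.imK_star, Quaternion.re_sub,
    Quaternion.imI_sub, Quaternion.imJ_sub, Quaternion.imK_sub, Quaternion.re_add,
    Quaternion.imI_add, Quaternion.imJ_add, Quaternion.imK_add]
  ring

instance : IsLeftCancelMulZero Octonion where
  mul_left_cancel_of_ne_zero {a} ha x y h := by
    have norm_eq_zero' : ‖a‖ * ‖x - y‖ = 0 := by
      rw [← Octonion.norm_mul, mul_sub, sub_eq_zero.2 h, norm_zero]
    exact sub_eq_zero.1 (norm_eq_zero.1
      ((mul_eq_zero.1 norm_eq_zero').resolve_left (norm_ne_zero_iff.2 ha)))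

theorem exists_eq_smul_one_of_mul_assoc {a : Octonion} (h : ∀ x y, a * (x * y) = (a * x) * y) :
    ∃ r : ℝ, a = r • (1 : Octonion) := by
  have commute_fst (c : ℍ[ℝ]) : a.fst * c = c * a.fst := by
    simpa using (congrArg (fun x : Octonion => star x.snd) (h (mk c 0) (mk 0 1))).symm
  have commutator_snd (c d : ℍ[ℝ]) : c * d * a.snd = d * (c * a.snd) := by
    simpa using congrArg snd (h (mk c 0) (mk d 0))
  have snd_eq_zero : a.snd = 0 := by
    by_contra hne
    have commutative (c d : ℍ[ℝ]) : c * d = d * c :=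
      mul_right_cancel₀ hne (by rw [commutator_snd, mul_assoc])
    obtain ⟨i, hi⟩ := (Quaternion.equivTuple ℝ).surjective ![0, 1, 0, 0]
    simp only [Quaternion.equivTuple_apply, Matrix.vecCons_inj] at hi
    have imI_eq := congrArg (fun y : ℍ[ℝ] => y.imI)
      (quaternion_eq_coe_re_of_commute (commutative i))
    simp [hi] at imI_eq
  refine ⟨a.fst.re, ext ?_ ?_⟩
  · rw [fst_smul, fst_one, ← Algebra.algebraMap_eq_smul_one]
    exact quaternion_eq_coe_re_of_commute commute_fst
  · rw [snd_eq_zero, snd_smul, snd_one, smul_zero]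

end Octonion

namespace Octonion

variable {n : ℕ}

variable (n) in
/-- Right multiplication on `𝕆ⁿ`, as a linear family of endomorphisms parametrised by `𝕆`. -/
def rightMulHom : Octonion →ₗ[ℝ] Module.End ℝ (LinearSpaceOver Octonion n) :=
  LinearMap.mk₂ ℝ (fun x v => rightMul v x)
    (fun x y v => PiLp.ext fun i => mul_add (v i) x y)
    (fun r x v => PiLp.ext fun i => mul_smul_comm r (v i) x)
    (fun x v w => PiLp.ext fun i => add_mul (v i) (w i) x)
    (fun r x v => PiLp.ext fun i => smul_mul_assoc r (v i) x)

theorem norm_rightMulHom_apply (x : Octonion) (v : LinearSpaceOver Octonion n) :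
    ‖rightMulHom n x v‖ = ‖x‖ * ‖v‖ := by
  rw [← sq_eq_sq₀ (norm_nonneg _) (by positivity), mul_pow, PiLp.norm_sq_eq_of_L2,
    PiLp.norm_sq_eq_of_L2, Finset.mul_sum]
  refine Finset.sum_congr rfl fun i _ => ?_
  change ‖v i * x‖ ^ 2 = _
  rw [Octonion.norm_mul, mul_pow, mul_comm]

theorem rightMulHom_one : rightMulHom n 1 = 1 :=
  LinearMap.ext rightMul_one

/-- The identification of the imaginary octonions with `ℝ⁷` by an orthonormal basis. -/
def imEquiv : (ℝ ∙ (1 : Octonion))ᗮ ≃ₗ[ℝ] (Fin 7 → ℝ) :=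
  (OrthonormalBasis.fromOrthogonalSpanSingleton 7 one_ne_zero).toBasis.equivFun

theorem euclideanForm7_imEquiv (u : (ℝ ∙ (1 : Octonion))ᗮ) :
    euclideanForm7 (imEquiv u) = ‖u‖ ^ 2 := by
  let b := OrthonormalBasis.fromOrthogonalSpanSingleton (𝕜 := ℝ) 7 (one_ne_zero (α := Octonion))
  calc euclideanForm7 (imEquiv u)
    _ = ∑ i, b.repr u i ^ 2 := by
      simp [euclideanForm7, QuadraticMap.weightedSumSquares_apply, imEquiv, b, sq]
    _ = ‖b.repr u‖ ^ 2 := (EuclideanSpace.real_norm_sq_eq _).symm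
    _ = ‖u‖ ^ 2 := by rw [b.repr.norm_map]

theorem eq_one_or_eq_neg_of_rightMul
    {ψ : LinearSpaceOver Octonion 1 ≃ₗᵢ[ℝ] LinearSpaceOver Octonion 1}
    (h : ∀ v x, ψ (rightMul v x) = rightMul (ψ v) x) : (∀ v, ψ v = v) ∨ ∀ v, ψ v = -v := by
  let line (x : Octonion) : LinearSpaceOver Octonion 1 := WithLp.toLp 2 fun _ => x
  have left_mul (x : Octonion) : ψ (line x) 0 = ψ (line 1) 0 * x := by
    rw [show line x = rightMul (line 1) x from PiLp.ext fun _ => (one_mul x).symm, h]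
    rfl
  obtain ⟨r, hr⟩ := exists_eq_smul_one_of_mul_assoc (a := ψ (line 1) 0) fun x y => by
    rw [← left_mul, ← left_mul, show line (x * y) = rightMul (line x) y from rfl, h]
    rfl
  have scalar (v : LinearSpaceOver Octonion 1) : ψ v = r • v := by
    have v_eq : v = line (v 0) := PiLp.ext fun i => congrArg v (Subsingleton.elim i 0)
    ext1 i
    calc ψ v i = ψ (line (v 0)) 0 := by rw [← v_eq, Subsingleton.elim i 0]
      _ = r • v 0 := by rw [left_mul, hr, smul_one_mul]
      _ = (r • v) i := by rw [Subsingleton.elim i 0]; rfl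
  have abs_r : |r| = 1 := by
    obtain ⟨v, hv⟩ := exists_ne (0 : LinearSpaceOver Octonion 1)
    refine mul_right_cancel₀ (norm_ne_zero_iff.2 hv) ?_
    rw [← Real.norm_eq_abs, ← norm_smul, ← scalar, ψ.norm_map, one_mul]
  refine (eq_or_eq_neg_of_abs_eq abs_r).imp ?_ ?_ <;> rintro rfl v <;> simp [scalar]

end Octonion

namespace Spin7

open CliffordAlgebra Octonion

variable {n : ℕ}

theorem generators_mul_self (m : Fin 7 → ℝ) :
    orthogonalGenerators (rightMulHom n) imEquiv m *
      orthogonalGenerators (rightMulHom n) imEquiv m = -algebraMap ℝ _ (euclideanForm7 m) :=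
  orthogonalGenerators_mul_self norm_rightMulHom_apply rightMulHom_one euclideanForm7_imEquiv m

variable (n) in
/-- The spin representation on `𝕆ⁿ`: right multiplication by an imaginary octonion `u` squares to
`-‖u‖²`, so the even Clifford algebra acts by `u₁ u₂ ↦ (v ↦ -(v u₂) u₁)`. -/
def spinRep : even euclideanForm7 →ₐ[ℝ] Module.End ℝ (LinearSpaceOver Octonion n) :=
  negEvenLift (orthogonalGenerators (rightMulHom n) imEquiv) generators_mul_self

variable (n) in
/-- The action of `Spin(7)` on `𝕆ⁿ` by isometries. -/
def isometryAction : Spin7 →* (LinearSpaceOver Octonion n ≃ₗᵢ[ℝ] LinearSpaceOver Octonion n) :=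
  spinAction generators_mul_self (star_orthogonalGenerators norm_rightMulHom_apply rightMulHom_one)

theorem isometryAction_apply (s : Spin7) (v : LinearSpaceOver Octonion n) :
    isometryAction n s v = spinRep n (Spin7.toEven s) v := rfl

theorem isometryAction_injective [NeZero n] : Function.Injective (isometryAction n) :=
  spinAction_injective _ _ euclideanForm7_imEquiv

theorem isometryAction_mem_twistedIso (s : Spin7) : isometryAction n s ∈ twistedIso Octonion n := by
  obtain ⟨θ, hθ, h⟩ := exists_rotation_negEvenLift_mul generators_mul_self rightMulHom_one
    euclideanForm7_imEquiv s
  exact ⟨θ, hθ, fun v x => LinearMap.congr_fun (h x) v⟩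

theorem exists_isometryAction_rightMul {θ : Octonion ≃ₗᵢ[ℝ] Octonion}
    (hθ : θ ∈ specialOrthogonal Octonion) (h1 : θ 1 = 1) :
    ∃ s, ∀ (v : LinearSpaceOver Octonion n) (x : Octonion),
      isometryAction n s (rightMul v x) = rightMul (isometryAction n s v) (θ x) := by
  obtain ⟨s, h⟩ := exists_spinGroup_negEvenLift_mul generators_mul_self rightMulHom_one
    euclideanForm7_imEquiv hθ h1
  exact ⟨s, fun v x => LinearMap.congr_fun (h x) v⟩

theorem exists_isometryAction_eq_neg : ∃ s, ∀ v, isometryAction n s v = -v := by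
  have euclidean_single : euclideanForm7 (Pi.single 0 1) = 1 := by
    simp [euclideanForm7, QuadraticMap.weightedSumSquares_apply, Pi.single_apply]
  refine ⟨⟨-1, neg_one_mem_spinGroup euclidean_single⟩, fun v => ?_⟩
  rw [isometryAction_apply, show Spin7.toEven _ = -1 from rfl, map_neg, map_one]
  rfl

theorem range_isometryAction : (isometryAction 1).range = twistedIso Octonion 1 := by
  apply le_antisymm
  · rintro _ ⟨s, rfl⟩
    exact isometryAction_mem_twistedIso s
  · rintro φ ⟨θ, hθ, h⟩
    obtain ⟨v, i, hvi⟩ := exists_isometry_apply_ne_zero φ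
    obtain ⟨s, hs⟩ := exists_isometryAction_rightMul (n := 1) hθ (twist_map_one h hvi)
    have commutes (v x) : ((isometryAction 1 s)⁻¹ * φ) (rightMul v x) =
        rightMul (((isometryAction 1 s)⁻¹ * φ) v) x := by
      apply (isometryAction 1 s).injective
      rw [hs]
      change (isometryAction 1 s * ((isometryAction 1 s)⁻¹ * φ)) _ =
        rightMul ((isometryAction 1 s * ((isometryAction 1 s)⁻¹ * φ)) v) _
      rw [mul_inv_cancel_left, h]
    rw [← mul_inv_cancel_left (isometryAction 1 s) φ]
    refine mul_mem ⟨s, rfl⟩ ?_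
    rcases eq_one_or_eq_neg_of_rightMul commutes with eq_id | eq_neg
    · exact (LinearIsometryEquiv.ext eq_id : _ = (1 : _ ≃ₗᵢ[ℝ] _)) ▸ one_mem _
    · obtain ⟨s', hs'⟩ := exists_isometryAction_eq_neg (n := 1)
      exact ⟨s', LinearIsometryEquiv.ext fun v => (hs' v).trans (eq_neg v).symm⟩

end Spin7

end

theorem mainTheorem2 :
    -- `G_ℝ(n) = O(n)`, acting on `ℝⁿ` by matrices
    (∀ n : ℕ, ∃ e : twistedIso ℝ n ≃* Matrix.orthogonalGroup (Fin n) ℝ,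
      ∀ (φ : twistedIso ℝ n) (v : LinearSpaceOver ℝ n),
        φ.1 v = WithLp.toLp 2 ((e φ).1 *ᵥ WithLp.ofLp v)) ∧
    -- `G_ℂ(n) = U(n)`, acting on `ℂⁿ` by matrices
    (∀ n : ℕ, ∃ e : twistedIso ℂ n ≃* Matrix.unitaryGroup (Fin n) ℂ,
      ∀ (φ : twistedIso ℂ n) (v : LinearSpaceOver ℂ n),
        φ.1 v = WithLp.toLp 2 ((e φ).1 *ᵥ WithLp.ofLp v)) ∧
    -- `G_ℍ(n) = Sp(n)Sp(1)`: the image of `Sp(n) × Sp(1)` acting on `ℍⁿ` by `v ↦ B v q⁻¹`,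
    -- that is, `Sp(n) × Sp(1)` modulo `{(1, 1), (-1, -1)}`
    (∀ n : ℕ, ∃ ρ : compactSp n × unitQuaternion →*
          (LinearSpaceOver ℍ[ℝ] n ≃ₗᵢ[ℝ] LinearSpaceOver ℍ[ℝ] n),
      (∀ (B : compactSp n) (q : unitQuaternion) (v : LinearSpaceOver ℍ[ℝ] n),
        ρ (B, q) v = rightMul (WithLp.toLp 2 (B.1 *ᵥ WithLp.ofLp v)) (q.1)⁻¹) ∧
      ρ.range = twistedIso ℍ[ℝ] n ∧
      (0 < n → ∀ (B : compactSp n) (q : unitQuaternion),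
        (B, q) ∈ ρ.ker ↔ (B.1 = 1 ∧ q.1 = 1) ∨ (B.1 = -1 ∧ q.1 = -1))) ∧
    -- `G_𝕆(1) = Spin(7)`, acting on `𝕆 = ℝ⁸` by the spin representation, i.e. by the restriction
    -- to `Spin(7)` of a representation of the even Clifford algebra of `ℝ⁷`
    (∃ (Ψ : CliffordAlgebra.even euclideanForm7 →ₐ[ℝ] Module.End ℝ (LinearSpaceOver Octonion 1))
        (e : Spin7 ≃* twistedIso Octonion 1),
      ∀ (s : Spin7) (v : LinearSpaceOver Octonion 1),
        (e s).1 v = Ψ (Spin7.toEven s) v) := by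
  refine ⟨exists_twistedIso_mulEquiv_unitary fun θ _ => isometry_real_eq_one θ,
    exists_twistedIso_mulEquiv_unitary rotation_complex_eq_one,
    fun n => ⟨biunitaryAction, fun B q v => ?_, range_biunitaryAction_quaternion, fun hn => ?_⟩,
    Spin7.spinRep 1,
    (MonoidHom.ofInjective Spin7.isometryAction_injective).trans
      (MulEquiv.subgroupCongr Spin7.range_isometryAction),
    Spin7.isometryAction_apply⟩
  · rw [biunitaryAction_apply, mulVecRep_apply, star_eq_inv_of_mem_unitary q.2]
  · have : NeZero n := ⟨hn.ne'⟩
    exact mem_ker_biunitaryAction_quaternion
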